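/- For $k\in\mathbb{Z}_{\ge 0}$, call a function $f\colon\mathbb{R}\to\mathbb{R}$ \emph{$k$-positive semidefinite} if for all $x_1,\dots,x_k\in\mathbb{R}$ the matrix $(f(x_i+x_j))_{1\le i,j\le k}$ is positive semidefinite, and \emph{$k$-positive definite} if for all pairwise different $x_1,\dots,x_k\in\mathbb{R}$ the matrix $(f(x_i+x_j))_{1\le i,j\le k}$ is positive definite. For every $k\in\mathbb{Z}_{\ge 0}$ there is a function $f\colon\mathbb{R}\to\mathbb{R}$ that is $k$-positive definite but not $(k+1)$-positive semidefinite. Explicitly, for all real numbers $0<a_1<\cdots<a_k$ there is $\epsilon_0>0$ such that for every $\epsilon$ with $0<\epsilon<\epsilon_0$ the function $$f_\epsilon(x)=\sum_{m=1}^k\left(e^{a_m x}+e^{-a_m x}\right)-\epsilon$$ is $k$-positive definite but not $(k+1)$-positive semidefinite. -/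

import Mathlib

/-- `f` is `k`-positive semidefinite: for all `x₁, …, x_k` (repetitions allowed), the matrix
`(f (x_i + x_j))` is positive semidefinite. -/
def KPosSemidef (k : ℕ) (f : ℝ → ℝ) : Prop :=
  ∀ x : Fin k → ℝ, (Matrix.of fun i j : Fin k => f (x i + x j)).PosSemidef

/-- `f` is `k`-positive definite: for all pairwise different `x₁, …, x_k`, the matrix
`(f (x_i + x_j))` is positive definite. -/
def KPosDef (k : ℕ) (f : ℝ → ℝ) : Prop :=
  ∀ x : Fin k → ℝ, Function.Injective x →
    (Matrix.of fun i j : Fin k => f (x i + x j)).PosDef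

/-- The function `x ↦ ∑ₘ (exp (aₘ x) + exp (-aₘ x)) - ε`. -/
noncomputable def expSumSub {k : ℕ} (a : Fin k → ℝ) (ε : ℝ) : ℝ → ℝ :=
  fun x => (∑ m : Fin k, (Real.exp (a m * x) + Real.exp (-a m * x))) - ε

/-! Put F(s) = ∑ cᵢ exp(xᵢ s). The quadratic form of the matrix of f_ε at c is ∑ₘ (F(aₘ)² + F(-aₘ)²)
- ε F(0)².

Positive definiteness for k points needs F(0)² ≤ C ∑ₘ (F(aₘ)² + F(-aₘ)²) with C independent of the
points and of c (`exists_sq_expSum_zero_le`). Let S consist of 0, as many aₘ as there are positive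
xᵢ, and as many -aₘ as there are nonpositive xᵢ. Since S has k + 1 elements, some nonzero
exponential sum with exponents b ∈ S and coefficients w_b vanishes at all xᵢ, whence ∑ w_b F(b) = 0.
It remains to bound |w_b| by a multiple of |w_0| uniformly in the zeros (`coeffBound`). Matching
signs is essential: for S = {0, 1} and a zero z, w_1 = -w_0 exp(-z), which is unbounded as z → -∞.

With k + 1 points, F can vanish at every aₘ but not at 0; translating the points to +∞ sends F(-aₘ)
to 0 and fixes F(0). -/

section

open Finset

/-! ### Zeros of exponential sums -/

/-- The exponential sum with exponents in `S` and coefficients `w`. -/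
noncomputable def expSum (S : Finset ℝ) (w : ℝ → ℝ) (x : ℝ) : ℝ :=
  ∑ b ∈ S, w b * Real.exp (b * x)

/-- The factor exp(-βt) makes the term with exponent β constant, so differentiation kills it and
leaves the zeros of the sum under control by Rolle. -/
theorem hasDerivAt_expSum_mul_exp (S : Finset ℝ) (w : ℝ → ℝ) (β x : ℝ) :
    HasDerivAt (fun t => expSum S w t * Real.exp (-β * t))
      (expSum S (fun b => (b - β) * w b) x * Real.exp (-β * x)) x := by
  have h1 : HasDerivAt (expSum S w) (∑ b ∈ S, w b * (Real.exp (b * x) * b)) x := by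
    refine HasDerivAt.fun_sum fun b _ => ?_
    have : HasDerivAt (fun t : ℝ => b * t) b x := by simpa using (hasDerivAt_id x).const_mul b
    exact this.exp.const_mul _
  have h2 : HasDerivAt (fun t : ℝ => Real.exp (-β * t)) (Real.exp (-β * x) * -β) x := by
    have : HasDerivAt (fun t : ℝ => -β * t) (-β) x := by
      simpa using (hasDerivAt_id x).const_mul (-β)
    exact this.exp
  refine (h1.mul h2).congr_deriv ?_
  simp only [expSum, Finset.sum_mul, ← Finset.sum_add_distrib]
  refine Finset.sum_congr rfl fun b _ => ?_
  ring

theorem expSum_erase (S : Finset ℝ) (w : ℝ → ℝ) (β x : ℝ) :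
    expSum (S.erase β) (fun b => (b - β) * w b) x = expSum S (fun b => (b - β) * w b) x :=
  Finset.sum_erase _ (by simp)

theorem expSum_neg (S : Finset ℝ) (w : ℝ → ℝ) (x : ℝ) :
    expSum (S.image Neg.neg) (fun b => w (-b)) x = expSum S w (-x) := by
  rw [expSum, Finset.sum_image (by simp)]
  simp [expSum]

/-- Rolle's theorem between two zeros, with the exponent `β` removed. -/
theorem exists_zero_between {S : Finset ℝ} {w : ℝ → ℝ} (β : ℝ) {u v : ℝ} (huv : u < v)
    (hu : expSum S w u = 0) (hv : expSum S w v = 0) :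
    ∃ t, u < t ∧ t < v ∧ expSum S (fun b => (b - β) * w b) t = 0 := by
  obtain ⟨t, ⟨h1, h2⟩, h3⟩ := exists_hasDerivAt_eq_zero huv
    (f := fun t => expSum S w t * Real.exp (-β * t))
    (fun x _ => (hasDerivAt_expSum_mul_exp S w β x).continuousAt.continuousWithinAt)
    (by simp [hu, hv]) (fun x _ => hasDerivAt_expSum_mul_exp S w β x)
  exact ⟨t, h1, h2, by simpa using h3⟩

/-- A finite set of zeros yields one fewer zeros after removing the exponent `β`. -/
theorem exists_zeros_between {S : Finset ℝ} {w : ℝ → ℝ} (β : ℝ) (Z : Finset ℝ)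
    (hZ : ∀ z ∈ Z, expSum S w z = 0) :
    ∃ Z' : Finset ℝ, Z'.card = Z.card - 1 ∧
      ∀ t ∈ Z', expSum S (fun b => (b - β) * w b) t = 0 ∧ (∃ u ∈ Z, u < t) ∧ ∃ v ∈ Z, t < v := by
  induction Z using Finset.induction_on_max with
  | empty => exact ⟨∅, by simp⟩
  | insert a s has ih =>
    rcases s.eq_empty_or_nonempty with rfl | hs
    · exact ⟨∅, by simp⟩
    obtain ⟨Z', hc, hZ'⟩ := ih fun z hz => hZ z (mem_insert_of_mem hz)
    have hm := s.max'_mem hs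
    obtain ⟨t, h1, h2, h3⟩ := exists_zero_between β (has _ hm)
      (hZ _ (mem_insert_of_mem hm)) (hZ a (mem_insert_self _ _))
    have htZ : t ∉ Z' := fun h => by
      obtain ⟨-, -, v, hv, htv⟩ := hZ' t h
      exact absurd (s.le_max' v hv) (not_le.2 (h1.trans htv))
    have has' : a ∉ s := fun h => lt_irrefl _ (has a h)
    refine ⟨insert t Z', ?_, ?_⟩
    · rw [card_insert_of_notMem htZ, card_insert_of_notMem has', hc]
      have := hs.card_pos
      omega
    · intro r hr
      rcases mem_insert.1 hr with rfl | hr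
      · exact ⟨h3, ⟨_, mem_insert_of_mem hm, h1⟩, a, mem_insert_self _ _, h2⟩
      · obtain ⟨h, ⟨u, hu, hur⟩, v, hv, hrv⟩ := hZ' r hr
        exact ⟨h, ⟨u, mem_insert_of_mem hu, hur⟩, v, mem_insert_of_mem hv, hrv⟩

/-- An exponential sum with at least as many zeros as exponents vanishes. -/
theorem coeff_eq_zero_of_card_le (S : Finset ℝ) (w : ℝ → ℝ) (Z : Finset ℝ)
    (hZ : ∀ z ∈ Z, expSum S w z = 0) (hc : S.card ≤ Z.card) : ∀ b ∈ S, w b = 0 := by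
  induction S using Finset.strongInduction generalizing w Z with
  | H S ih =>
    intro β hβ
    obtain ⟨Z', hc', hZ'⟩ := exists_zeros_between β Z hZ
    have hpos := card_pos.2 ⟨β, hβ⟩
    have key := ih (S.erase β) (erase_ssubset hβ) (fun b => (b - β) * w b) Z'
      (fun z hz => by rw [expSum_erase]; exact (hZ' z hz).1)
      (by rw [card_erase_of_mem hβ, hc']; omega)
    -- All other coefficients vanish by `key`, so a single zero forces w β = 0.
    obtain ⟨z, hz⟩ : Z.Nonempty := card_pos.1 (by omega)
    have h0 := hZ z hz
    rw [expSum, ← Finset.add_sum_erase _ _ hβ, Finset.sum_eq_zero, add_zero] at h0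
    · simpa using h0
    · intro b hb
      have := key b hb
      rcases mul_eq_zero.1 this with h | h
      · exact absurd (sub_eq_zero.1 h) (ne_of_mem_erase hb)
      · simp [h]

/-! ### Coefficient bounds uniform in the zeros -/

/-- The numbers of nonpositive and of nonnegative zeros of the exponential sum match the numbers
of negative and of positive exponents. -/
structure ZeroSplit (S : Finset ℝ) (w : ℝ → ℝ) (Zn Zp : Finset ℝ) : Prop where
  neg_zero : ∀ z ∈ Zn, expSum S w z = 0
  pos_zero : ∀ z ∈ Zp, expSum S w z = 0
  nonpos : ∀ z ∈ Zn, z ≤ 0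
  nonneg : ∀ z ∈ Zp, 0 ≤ z
  lt : ∀ y ∈ Zn, ∀ z ∈ Zp, y < z
  card_neg : Zn.card = (S.filter (· < 0)).card
  card_pos : Zp.card = (S.filter (0 < ·)).card

theorem ZeroSplit.reflect {S : Finset ℝ} {w : ℝ → ℝ} {Zn Zp : Finset ℝ} (h : ZeroSplit S w Zn Zp) :
    ZeroSplit (S.image Neg.neg) (fun b => w (-b)) (Zp.image Neg.neg) (Zn.image Neg.neg) where
  neg_zero := by
    intro z hz
    obtain ⟨y, hy, rfl⟩ := mem_image.1 hz
    simpa [expSum_neg] using h.pos_zero y hy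
  pos_zero := by
    intro z hz
    obtain ⟨y, hy, rfl⟩ := mem_image.1 hz
    simpa [expSum_neg] using h.neg_zero y hy
  nonpos := by
    intro z hz
    obtain ⟨y, hy, rfl⟩ := mem_image.1 hz
    simpa using h.nonneg y hy
  nonneg := by
    intro z hz
    obtain ⟨y, hy, rfl⟩ := mem_image.1 hz
    simpa using h.nonpos y hy
  lt := by
    intro y hy z hz
    obtain ⟨u, hu, rfl⟩ := mem_image.1 hy
    obtain ⟨v, hv, rfl⟩ := mem_image.1 hz
    simpa using h.lt v hv u hu
  card_neg := by
    rw [card_image_of_injective _ neg_injective, h.card_pos, filter_image,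
      card_image_of_injective _ neg_injective]
    simp
  card_pos := by
    rw [card_image_of_injective _ neg_injective, h.card_neg, filter_image,
      card_image_of_injective _ neg_injective]
    simp

/-- All coefficients are controlled by the constant one, uniformly in the zeros. -/
def CoeffBound (S : Finset ℝ) : Prop :=
  ∃ C : ℝ, ∀ w Zn Zp, ZeroSplit S w Zn Zp → ∀ b ∈ S, |w b| ≤ C * |w 0|

theorem CoeffBound.reflect {S : Finset ℝ} (h : CoeffBound S) :
    CoeffBound (S.image Neg.neg) := by
  obtain ⟨C, hC⟩ := h
  refine ⟨C, fun w Zn Zp hz b hb => ?_⟩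
  have h2 := hz.reflect
  have e : (S.image Neg.neg).image Neg.neg = S := by
    rw [image_image]; simp
  rw [e] at h2
  obtain ⟨c, hc, rfl⟩ := mem_image.1 hb
  simpa using hC _ _ _ h2 c hc

/-- Removing the largest exponent, provided the number of nonpositive zeros is preserved. -/
theorem bound_of_erase_max {S : Finset ℝ} {M : ℝ} (hMS : M ∈ S) (hM : 0 < M)
    (hmax : ∀ b ∈ S, b ≤ M) (hb : CoeffBound (S.erase M)) :
    ∃ C : ℝ, ∀ w Zn Zp, ZeroSplit S w Zn Zp →
      (∃ Zn' : Finset ℝ, Zn'.card = Zn.card ∧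
        ∀ z ∈ Zn', z ≤ 0 ∧ expSum S (fun b => (b - M) * w b) z = 0) →
      ∀ b ∈ S, |w b| ≤ C * |w 0| := by
  obtain ⟨C, hC⟩ := hb
  -- After removal of M the constant coefficient is -M * w 0 and the others are (b - M) * w b, hence
  -- the summands; summing them also controls w M.
  set K : ℝ := ∑ b ∈ S.erase M, |C| * M / (M - b) with hK
  have hlt : ∀ b ∈ S.erase M, b < M := fun b hb =>
    lt_of_le_of_ne (hmax b (mem_of_mem_erase hb)) (ne_of_mem_erase hb)
  refine ⟨K, fun w Zn Zp hz hn => ?_⟩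
  obtain ⟨Zn', hcn, hZn'⟩ := hn
  obtain ⟨Zp', hcp, hZp'⟩ := exists_zeros_between M Zp hz.pos_zero
  have hfp : ((S.erase M).filter (0 < ·)).card = (S.filter (0 < ·)).card - 1 := by
    rw [filter_erase, card_erase_of_mem (by simp [hMS, hM])]
  have hfn : ((S.erase M).filter (· < 0)).card = (S.filter (· < 0)).card := by
    rw [filter_erase, erase_eq_of_notMem (by simp [hM.le])]
  -- Rolle zeros are strictly inside, so they stay apart from `Zn'` even if 0 ∈ `Zn'`.
  have hpos : ∀ z ∈ Zp', 0 < z := fun z hz' => by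
    obtain ⟨-, ⟨u, hu, huz⟩, -⟩ := hZp' z hz'
    exact (hz.nonneg u hu).trans_lt huz
  have hsplit : ZeroSplit (S.erase M) (fun b => (b - M) * w b) Zn' Zp' :=
    { neg_zero := fun z h => by rw [expSum_erase]; exact (hZn' z h).2
      pos_zero := fun z h => by rw [expSum_erase]; exact (hZp' z h).1
      nonpos := fun z h => (hZn' z h).1
      nonneg := fun z h => (hpos z h).le
      lt := fun y hy z h => (hZn' y hy).1.trans_lt (hpos z h)
      card_neg := by rw [hcn, hz.card_neg, hfn]
      card_pos := by rw [hcp, hz.card_pos, hfp] }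
  have h1 : ∀ b ∈ S.erase M, |w b| ≤ |C| * M / (M - b) * |w 0| := by
    intro b hb
    have h := hC _ _ _ hsplit b hb
    have hbM := sub_pos.2 (hlt b hb)
    rw [abs_mul, abs_mul, abs_sub_comm, abs_of_pos hbM, zero_sub, abs_neg, abs_of_pos hM] at h
    rw [div_mul_eq_mul_div, le_div_iff₀ hbM]
    have := mul_le_mul_of_nonneg_right (le_abs_self C) (mul_nonneg hM.le (abs_nonneg (w 0)))
    linarith
  have hsum : ∑ b ∈ S.erase M, |w b| ≤ K * |w 0| := by
    rw [hK, Finset.sum_mul]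
    exact Finset.sum_le_sum h1
  intro b hb
  refine le_trans ?_ hsum
  by_cases hbM : b = M
  · subst hbM
    -- At a zero z ≥ 0 the exponential with the largest exponent dominates the others.
    obtain ⟨z, hzz⟩ : Zp.Nonempty := by
      rw [← Finset.card_pos, hz.card_pos, Finset.card_pos]
      exact ⟨b, by simp [hb, hM]⟩
    have h0 := hz.pos_zero z hzz
    have hz0 := hz.nonneg z hzz
    rw [expSum, ← Finset.add_sum_erase _ _ hb] at h0
    have h2 : |w b| * Real.exp (b * z) ≤ (∑ c ∈ S.erase b, |w c|) * Real.exp (b * z) := by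
      calc |w b| * Real.exp (b * z) = |w b * Real.exp (b * z)| := by
            rw [abs_mul, abs_of_pos (Real.exp_pos _)]
        _ = |∑ c ∈ S.erase b, w c * Real.exp (c * z)| := by
            rw [eq_neg_of_add_eq_zero_left h0, abs_neg]
        _ ≤ ∑ c ∈ S.erase b, |w c * Real.exp (c * z)| := abs_sum_le_sum_abs _ _
        _ ≤ _ := by
            rw [Finset.sum_mul]
            refine Finset.sum_le_sum fun c hc => ?_
            rw [abs_mul, abs_of_pos (Real.exp_pos _)]
            have := (hlt c hc).le
            gcongr
    exact le_of_mul_le_mul_right h2 (Real.exp_pos _)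
  · exact Finset.single_le_sum (f := fun b => |w b|) (fun _ _ => abs_nonneg _)
      (mem_erase.2 ⟨hbM, hb⟩)

theorem bound_of_erase_min {S : Finset ℝ} {m : ℝ} (hmS : m ∈ S) (hm : m < 0)
    (hmin : ∀ b ∈ S, m ≤ b) (hb : CoeffBound (S.erase m)) :
    ∃ C : ℝ, ∀ w Zn Zp, ZeroSplit S w Zn Zp →
      (∃ Zp' : Finset ℝ, Zp'.card = Zp.card ∧
        ∀ z ∈ Zp', 0 ≤ z ∧ expSum S (fun b => (b - m) * w b) z = 0) →
      ∀ b ∈ S, |w b| ≤ C * |w 0| := by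
  have e : (S.image Neg.neg).erase (-m) = (S.erase m).image Neg.neg := by
    rw [image_erase neg_injective]
  obtain ⟨C, hC⟩ := bound_of_erase_max (S := S.image Neg.neg) (M := -m)
    (mem_image_of_mem _ hmS) (by linarith) (by simpa using fun b hb => hmin (b) hb)
    (by rw [e]; exact hb.reflect)
  refine ⟨C, fun w Zn Zp hz ⟨Zp', hc, hZ⟩ b hbS => ?_⟩
  have := hC _ _ _ hz.reflect ⟨Zp'.image Neg.neg, by
      rw [card_image_of_injective _ neg_injective, card_image_of_injective _ neg_injective, hc], by
      intro z hz'
      obtain ⟨y, hy, rfl⟩ := mem_image.1 hz'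
      refine ⟨by simpa using (hZ y hy).1, ?_⟩
      have h1 := expSum_neg S (fun b => -((b - m) * w b)) (-y)
      have h2 := (hZ y hy).2
      simp only [neg_neg] at h1
      have h3 : expSum S (fun b => -((b - m) * w b)) y = 0 := by
        simpa [expSum, Finset.sum_neg_distrib] using h2
      rw [h3] at h1
      rw [← h1]
      congr 1
      funext b
      ring⟩ (-b) (mem_image_of_mem _ hbS)
  simpa using this

/-! ### The additional zero near the origin -/

/-- A function vanishing at `y`, positive and nonincreasing at `c > y`, has a critical point
in `(y, c]`. -/
theorem exists_critical_point {g g' : ℝ → ℝ} (hg : ∀ x, HasDerivAt g (g' x) x) {y c : ℝ}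
    (hy : y < c) (hgy : g y = 0) (h0 : 0 < g c) (h0' : g' c ≤ 0) :
    ∃ t, y < t ∧ t ≤ c ∧ g' t = 0 := by
  by_contra! hne
  have hneg : g' c < 0 := lt_of_le_of_ne h0' (hne c hy le_rfl)
  -- The mean value theorem gives a positive derivative before c; Darboux's theorem then gives a
  -- zero of g'.
  obtain ⟨t, ⟨h1, h2⟩, h3⟩ := exists_hasDerivAt_eq_slope g g' hy
    (fun x _ => (hg x).continuousAt.continuousWithinAt) (fun x _ => hg x)
  have hpos : 0 < g' t := by
    rw [h3, hgy, sub_zero]; exact div_pos h0 (sub_pos.2 hy)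
  obtain ⟨s, ⟨h4, h5⟩, h6⟩ := exists_hasDerivWithinAt_eq_of_lt_of_gt h2.le
    (fun x _ => (hg x).hasDerivWithinAt) hpos hneg
  exact hne s (h1.trans h4) h5.le h6

theorem exists_zero_left {S : Finset ℝ} {w : ℝ → ℝ} {β y : ℝ} (hy : y < 0)
    (h0 : expSum S w y = 0) (hpos : 0 < expSum S w 0)
    (hd : expSum S (fun b => (b - β) * w b) 0 ≤ 0) :
    ∃ t, y < t ∧ t ≤ 0 ∧ expSum S (fun b => (b - β) * w b) t = 0 := by
  obtain ⟨t, h1, h2, h3⟩ := exists_critical_point (hasDerivAt_expSum_mul_exp S w β) hy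
    (by simp [h0]) (by simpa using hpos) (by simpa using hd)
  exact ⟨t, h1, h2, by simpa using h3⟩

theorem expSum_sub_mul (S : Finset ℝ) (w : ℝ → ℝ) (β x : ℝ) :
    expSum S (fun b => (b - β) * w b) x = expSum S (fun b => b * w b) x - β * expSum S w x := by
  simp only [expSum, Finset.mul_sum, ← Finset.sum_sub_distrib]
  exact Finset.sum_congr rfl fun b _ => by ring

theorem expSum_neg_coeff (S : Finset ℝ) (w : ℝ → ℝ) (x : ℝ) :
    expSum S (fun b => -w b) x = -expSum S w x := by
  simp [expSum, Finset.sum_neg_distrib]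

theorem exists_zero_right {S : Finset ℝ} {w : ℝ → ℝ} {β z : ℝ} (hz : 0 < z)
    (h0 : expSum S w z = 0) (hpos : 0 < expSum S w 0)
    (hd : 0 ≤ expSum S (fun b => (b - β) * w b) 0) :
    ∃ t, 0 ≤ t ∧ t < z ∧ expSum S (fun b => (b - β) * w b) t = 0 := by
  have e : ∀ x, expSum (S.image Neg.neg) (fun b => (b - -β) * w (-b)) x
      = -expSum S (fun b => (b - β) * w b) (-x) := by
    intro x
    rw [← expSum_neg, ← expSum_neg_coeff]
    congr 1
    funext b
    ring
  obtain ⟨t, h1, h2, h3⟩ := exists_zero_left (S := S.image Neg.neg) (w := fun b => w (-b))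
    (β := -β) (y := -z) (by linarith) (by simpa [expSum_neg] using h0)
    (by simpa [expSum_neg] using hpos) (by rw [e]; simpa using hd)
  rw [e] at h3
  exact ⟨-t, by linarith, by linarith, by linarith⟩

/-- Between a nonpositive and a nonnegative zero, removing the exponent `M` leaves a nonpositive
zero or removing the exponent `m` leaves a nonnegative one. -/
theorem exists_zero_left_or_right {S : Finset ℝ} {w : ℝ → ℝ} {m M y z : ℝ} (hmM : m ≤ M)
    (hy : y ≤ 0) (hz : 0 ≤ z) (hyz : y < z) (h0y : expSum S w y = 0) (h0z : expSum S w z = 0) :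
    (∃ t, y < t ∧ t ≤ 0 ∧ expSum S (fun b => (b - M) * w b) t = 0) ∨
      ∃ t, 0 ≤ t ∧ t < z ∧ expSum S (fun b => (b - m) * w b) t = 0 := by
  rcases hy.eq_or_lt with rfl | hy
  · obtain ⟨t, h1, h2, h3⟩ := exists_zero_between m hyz h0y h0z
    exact .inr ⟨t, h1.le, h2, h3⟩
  rcases hz.eq_or_lt with rfl | hz
  · obtain ⟨t, h1, h2, h3⟩ := exists_zero_between M hyz h0y h0z
    exact .inl ⟨t, h1, h2.le, h3⟩
  have key : ∀ v : ℝ → ℝ, expSum S v y = 0 → expSum S v z = 0 → 0 < expSum S v 0 →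
      (∃ t, y < t ∧ t ≤ 0 ∧ expSum S (fun b => (b - M) * v b) t = 0) ∨
      ∃ t, 0 ≤ t ∧ t < z ∧ expSum S (fun b => (b - m) * v b) t = 0 := by
    intro v hvy hvz hv
    -- If v'(0) ≤ M v(0), the left side gains a zero; otherwise v'(0) ≥ M v(0) ≥ m v(0), and the
    -- right side does.
    rcases le_total (expSum S (fun b => (b - M) * v b) 0) 0 with h | h
    · exact .inl (exists_zero_left hy hvy hv h)
    · refine .inr (exists_zero_right hz hvz hv ?_)
      rw [expSum_sub_mul] at h ⊢
      nlinarith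
  rcases lt_trichotomy (expSum S w 0) 0 with h | h | h
  · have := key (fun b => -w b) (by simp [expSum_neg_coeff, h0y])
      (by simp [expSum_neg_coeff, h0z]) (by simpa [expSum_neg_coeff] using h)
    simpa [expSum_neg_coeff] using this
  · obtain ⟨t, h1, h2, h3⟩ := exists_zero_between M hy h0y h
    exact .inl ⟨t, h1, h2.le, h3⟩
  · exact key w h0y h0z h

/-- A zero to the right of `Z` compensates the one lost by differentiation. -/
theorem exists_zeros_nonpos {S : Finset ℝ} {w : ℝ → ℝ} {β t : ℝ} (Z : Finset ℝ) (hne : Z.Nonempty)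
    (hZ : ∀ z ∈ Z, expSum S w z = 0) (ht : ∀ z ∈ Z, z < t) (ht0 : t ≤ 0)
    (h : expSum S (fun b => (b - β) * w b) t = 0) :
    ∃ Z' : Finset ℝ, Z'.card = Z.card ∧
      ∀ z ∈ Z', z ≤ 0 ∧ expSum S (fun b => (b - β) * w b) z = 0 := by
  obtain ⟨Z', hc, hZ'⟩ := exists_zeros_between β Z hZ
  have hlt : ∀ z ∈ Z', z < t := fun z hz => by
    obtain ⟨-, -, v, hv, hzv⟩ := hZ' z hz
    exact hzv.trans (ht v hv)
  refine ⟨insert t Z', ?_, ?_⟩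
  · rw [card_insert_of_notMem fun h => lt_irrefl _ (hlt t h), hc]
    have := hne.card_pos
    omega
  · intro z hz
    rcases mem_insert.1 hz with rfl | hz
    · exact ⟨ht0, h⟩
    · exact ⟨(hlt z hz).le.trans ht0, (hZ' z hz).1⟩

theorem exists_zeros_nonneg {S : Finset ℝ} {w : ℝ → ℝ} {β t : ℝ} (Z : Finset ℝ) (hne : Z.Nonempty)
    (hZ : ∀ z ∈ Z, expSum S w z = 0) (ht : ∀ z ∈ Z, t < z) (ht0 : 0 ≤ t)
    (h : expSum S (fun b => (b - β) * w b) t = 0) :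
    ∃ Z' : Finset ℝ, Z'.card = Z.card ∧
      ∀ z ∈ Z', 0 ≤ z ∧ expSum S (fun b => (b - β) * w b) z = 0 := by
  obtain ⟨Z', hc, hZ'⟩ := exists_zeros_between β Z hZ
  have hlt : ∀ z ∈ Z', t < z := fun z hz => by
    obtain ⟨-, ⟨v, hv, hzv⟩, -⟩ := hZ' z hz
    exact (ht v hv).trans hzv
  refine ⟨insert t Z', ?_, ?_⟩
  · rw [card_insert_of_notMem fun h => lt_irrefl _ (hlt t h), hc]
    have := hne.card_pos
    omega
  · intro z hz
    rcases mem_insert.1 hz with rfl | hz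
    · exact ⟨ht0, h⟩
    · exact ⟨ht0.trans (hlt z hz).le, (hZ' z hz).1⟩

/-- Rolle costs one zero on each side of the origin, but deleting an extreme nonzero exponent lowers
only one of the two counts. `exists_zero_left_or_right` restores a zero on one side and so decides
which extreme exponent to delete. -/
theorem coeffBound (S : Finset ℝ) (h0 : (0 : ℝ) ∈ S) : CoeffBound S := by
  induction S using Finset.strongInduction with
  | H S ih =>
    have hne : S.Nonempty := ⟨0, h0⟩
    set M := S.max' hne with hM
    set m := S.min' hne with hm
    have hMS : M ∈ S := S.max'_mem hne
    have hmS : m ∈ S := S.min'_mem hne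
    have hmax : ∀ b ∈ S, b ≤ M := fun b hb => S.le_max' b hb
    have hmin : ∀ b ∈ S, m ≤ b := fun b hb => S.min'_le b hb
    have right := fun hpos : 0 < M => bound_of_erase_max hMS hpos hmax
      (ih _ (erase_ssubset hMS) (mem_erase.2 ⟨hpos.ne, h0⟩))
    have left := fun hneg : m < 0 => bound_of_erase_min hmS hneg hmin
      (ih _ (erase_ssubset hmS) (mem_erase.2 ⟨hneg.ne', h0⟩))
    rcases (hmax 0 h0).eq_or_lt with hM0 | hM0 <;> rcases (hmin 0 h0).eq_or_lt with hm0 | hm0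
    · refine ⟨1, fun w Zn Zp hz b hb => ?_⟩
      have : b = 0 := le_antisymm (hM0 ▸ hmax b hb) (hm0 ▸ hmin b hb)
      simp [this]
    · obtain ⟨C, hC⟩ := left hm0
      refine ⟨C, fun w Zn Zp hz => hC w Zn Zp hz ⟨∅, ?_, by simp⟩⟩
      rw [hz.card_pos, card_empty, eq_comm, card_eq_zero, filter_eq_empty_iff]
      exact fun b hb => not_lt.2 (hM0 ▸ hmax b hb)
    · obtain ⟨C, hC⟩ := right hM0
      refine ⟨C, fun w Zn Zp hz => hC w Zn Zp hz ⟨∅, ?_, by simp⟩⟩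
      rw [hz.card_neg, card_empty, eq_comm, card_eq_zero, filter_eq_empty_iff]
      exact fun b hb => not_lt.2 (hm0 ▸ hmin b hb)
    · obtain ⟨C₁, hC₁⟩ := left hm0
      obtain ⟨C₂, hC₂⟩ := right hM0
      refine ⟨max C₁ C₂, fun w Zn Zp hz b hb => ?_⟩
      have hn : Zn.Nonempty := by
        rw [← Finset.card_pos, hz.card_neg, Finset.card_pos]
        exact ⟨m, by simp [hmS, hm0]⟩
      have hp : Zp.Nonempty := by
        rw [← Finset.card_pos, hz.card_pos, Finset.card_pos]
        exact ⟨M, by simp [hMS, hM0]⟩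
      have hy := Zn.max'_mem hn
      have hz' := Zp.min'_mem hp
      rcases exists_zero_left_or_right (hmin M hMS) (hz.nonpos _ hy) (hz.nonneg _ hz')
        (hz.lt _ hy _ hz') (hz.neg_zero _ hy) (hz.pos_zero _ hz') with
        ⟨t, h1, h2, h3⟩ | ⟨t, h1, h2, h3⟩
      · refine (hC₂ w Zn Zp hz (exists_zeros_nonpos Zn hn hz.neg_zero
          (fun z h => (Zn.le_max' z h).trans_lt h1) h2 h3) b hb).trans ?_
        gcongr
        exact le_max_right _ _
      · refine (hC₁ w Zn Zp hz (exists_zeros_nonneg Zp hp hz.pos_zero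
          (fun z h => h2.trans_le (Zp.min'_le z h)) h1 h3) b hb).trans ?_
        gcongr
        exact le_max_left _ _

/-! ### Duality and the bound at 0 -/

theorem exists_coeff_ne_zero (S Z : Finset ℝ) (h : Z.card < S.card) :
    ∃ w : ℝ → ℝ, (∃ b ∈ S, w b ≠ 0) ∧ ∀ z ∈ Z, expSum S w z = 0 := by
  let L : (S → ℝ) →ₗ[ℝ] (Z → ℝ) :=
    { toFun := fun w z => ∑ b, w b * Real.exp (b * z)
      map_add' := fun u v => by ext z; simp [add_mul, Finset.sum_add_distrib]
      map_smul' := fun r v => by ext z; simp [mul_assoc, Finset.mul_sum] }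
  have hk := LinearMap.ker_ne_bot_of_finrank_lt (f := L) (by simpa using h)
  obtain ⟨w, hw, hne⟩ := (Submodule.ne_bot_iff _).1 hk
  obtain ⟨b, hb⟩ := Function.ne_iff.1 hne
  refine ⟨fun b => if h : b ∈ S then w ⟨b, h⟩ else 0, ⟨b, b.2, by simpa using hb⟩, fun z hz => ?_⟩
  have := congrFun (LinearMap.mem_ker.1 hw) ⟨z, hz⟩
  rw [expSum, ← Finset.sum_coe_sort]
  simpa [L] using this

/-- The value at `0` of an exponential sum with `k` terms is controlled by the values at `k` points
matching the signs of the exponents. -/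
theorem exists_abs_expSum_zero_le (S : Finset ℝ) (h0 : (0 : ℝ) ∈ S) :
    ∃ C : ℝ, ∀ (X : Finset ℝ) (c : ℝ → ℝ),
      (X.filter (· ≤ 0)).card = (S.filter (· < 0)).card →
      (X.filter (0 < ·)).card = (S.filter (0 < ·)).card →
      |expSum X c 0| ≤ C * ∑ b ∈ S.erase 0, |expSum X c b| := by
  obtain ⟨C, hC⟩ := coeffBound S h0
  refine ⟨C, fun X c hn hp => ?_⟩
  have hX : X.card < S.card := by
    have h1 := card_filter_add_card_filter_not (s := X) (· ≤ 0)
    have h2 := card_filter_add_card_filter_not (s := S.erase 0) (· < 0)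
    simp only [not_le] at h1
    have h3 : (S.erase 0).filter (fun b => ¬ b < 0) = S.filter (0 < ·) := by
      ext b
      simp only [mem_filter, mem_erase, not_lt]
      exact ⟨fun h => ⟨h.1.2, lt_of_le_of_ne h.2 (Ne.symm h.1.1)⟩, fun h => ⟨⟨h.2.ne', h.1⟩, h.2.le⟩⟩
    have h4 : (S.erase 0).filter (· < 0) = S.filter (· < 0) := by
      rw [filter_erase, erase_eq_of_notMem (by simp)]
    rw [h3, h4] at h2
    have := card_erase_add_one h0
    omega
  obtain ⟨w, ⟨b, hb, hwb⟩, hw⟩ := exists_coeff_ne_zero S X hX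
  have hbd := hC w _ _
    { neg_zero := fun z hz => hw z (mem_of_mem_filter z hz)
      pos_zero := fun z hz => hw z (mem_of_mem_filter z hz)
      nonpos := fun z hz => (mem_filter.1 hz).2
      nonneg := fun z hz => (mem_filter.1 hz).2.le
      lt := fun y hy z hz => (mem_filter.1 hy).2.trans_lt (mem_filter.1 hz).2
      card_neg := hn
      card_pos := hp }
  -- If w 0 = 0, the bound would kill every coefficient.
  have hw0 : 0 < |w 0| := by
    rw [abs_pos]
    intro h
    have := hbd b hb
    rw [h, abs_zero, mul_zero] at this
    exact hwb (abs_nonpos_iff.1 this)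
  -- Points and exponents play symmetric roles in exp(b * x).
  have hdual : ∑ b ∈ S, w b * expSum X c b = 0 := by
    have : ∑ b ∈ S, w b * expSum X c b = ∑ x ∈ X, c x * expSum S w x := by
      simp only [expSum, Finset.mul_sum]
      rw [Finset.sum_comm]
      refine Finset.sum_congr rfl fun x _ => Finset.sum_congr rfl fun b _ => ?_
      rw [mul_comm x b]
      ring
    rw [this]
    exact Finset.sum_eq_zero fun x hx => by rw [hw x hx, mul_zero]
  rw [← Finset.add_sum_erase _ _ h0] at hdual
  refine le_of_mul_le_mul_left ?_ hw0
  calc |w 0| * |expSum X c 0| = |∑ b ∈ S.erase 0, w b * expSum X c b| := by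
        rw [← abs_mul, eq_neg_of_add_eq_zero_left hdual, abs_neg]
    _ ≤ ∑ b ∈ S.erase 0, |w b * expSum X c b| := abs_sum_le_sum_abs _ _
    _ ≤ ∑ b ∈ S.erase 0, C * |w 0| * |expSum X c b| := by
        refine Finset.sum_le_sum fun b hb => ?_
        rw [abs_mul]
        gcongr
        exact hbd b (mem_of_mem_erase hb)
    _ = |w 0| * (C * ∑ b ∈ S.erase 0, |expSum X c b|) := by
        rw [← Finset.mul_sum]; ring

/-- A bound uniform in the exponents, in terms of the values at the points `±b`, `b ∈ A`. -/
theorem exists_sq_expSum_zero_le (A : Finset ℝ) (hA : ∀ b ∈ A, 0 < b) :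
    ∃ C : ℝ, 0 < C ∧ ∀ (X : Finset ℝ) (c : ℝ → ℝ), X.card = A.card →
      expSum X c 0 ^ 2 ≤ C * ∑ b ∈ A, (expSum X c b ^ 2 + expSum X c (-b) ^ 2) := by
  set N : Finset ℝ := A.image Neg.neg with hN
  have hNneg : ∀ b ∈ N, b < 0 := by
    intro b hb
    obtain ⟨d, hd, rfl⟩ := mem_image.1 hb
    simpa using hA d hd
  have hNcard : N.card = A.card := card_image_of_injective _ neg_injective
  have hdisj : Disjoint A N := Finset.disjoint_left.2 fun b h1 h2 => (hA b h1).not_gt (hNneg b h2)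
  have h1 : ∀ S : Finset ℝ, ∃ C : ℝ, (0 : ℝ) ∈ S → ∀ (X : Finset ℝ) (c : ℝ → ℝ),
      (X.filter (· ≤ 0)).card = (S.filter (· < 0)).card →
      (X.filter (0 < ·)).card = (S.filter (0 < ·)).card →
      |expSum X c 0| ≤ C * ∑ b ∈ S.erase 0, |expSum X c b| := by
    intro S
    by_cases h0 : (0 : ℝ) ∈ S
    · obtain ⟨C, hC⟩ := exists_abs_expSum_zero_le S h0
      exact ⟨C, fun _ => hC⟩
    · exact ⟨0, fun h => absurd h h0⟩
  choose C hC using h1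
  set T := insert 0 (A ∪ N) with hT
  -- S depends on the signs of X; summing over all candidate sets makes the constant independent of
  -- X.
  set K : ℝ := ∑ S ∈ T.powerset, |C S| with hK
  have hK0 : 0 ≤ K := Finset.sum_nonneg fun _ _ => abs_nonneg _
  -- K² times the cardinality comes from Cauchy–Schwarz; the 1 ensures positivity.
  refine ⟨K ^ 2 * (A ∪ N).card + 1, by positivity, fun X c hX => ?_⟩
  have hcard := card_filter_add_card_filter_not (s := X) (· ≤ 0)
  simp only [not_le] at hcard
  obtain ⟨A', hA', hA'c⟩ := exists_subset_card_eq (s := A) (n := (X.filter (0 < ·)).card) (by omega)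
  obtain ⟨N', hN', hN'c⟩ := exists_subset_card_eq (s := N) (n := (X.filter (· ≤ 0)).card) (by omega)
  set S := insert 0 (A' ∪ N') with hS
  have hSn : S.filter (· < 0) = N' := by
    ext b
    simp only [hS, mem_filter, mem_insert, mem_union]
    constructor
    · rintro ⟨rfl | h | h, hb⟩
      · exact absurd hb (lt_irrefl _)
      · exact absurd hb (hA b (hA' h)).not_gt
      · exact h
    · exact fun h => ⟨.inr (.inr h), hNneg b (hN' h)⟩
  have hSp : S.filter (0 < ·) = A' := by
    ext b
    simp only [hS, mem_filter, mem_insert, mem_union]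
    constructor
    · rintro ⟨rfl | h | h, hb⟩
      · exact absurd hb (lt_irrefl _)
      · exact h
      · exact absurd hb (hNneg b (hN' h)).not_gt
    · exact fun h => ⟨.inr (.inl h), hA b (hA' h)⟩
  have h := hC S (mem_insert_self _ _) X c (by rw [hSn, hN'c]) (by rw [hSp, hA'c])
  have hsub : S.erase 0 ⊆ A ∪ N := by
    intro b hb
    obtain ⟨hb0, hb⟩ := mem_erase.1 hb
    rcases mem_insert.1 hb with h | h
    · exact absurd h hb0
    · exact union_subset_union hA' hN' h
  have hST : S ∈ T.powerset := mem_powerset.2 (insert_subset_insert _ (union_subset_union hA' hN'))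
  have hCK : C S ≤ K := (le_abs_self _).trans
    (Finset.single_le_sum (f := fun S => |C S|) (fun _ _ => abs_nonneg _) hST)
  have h2 : |expSum X c 0| ≤ K * ∑ b ∈ A ∪ N, |expSum X c b| := by
    refine h.trans (mul_le_mul hCK ?_ (Finset.sum_nonneg fun _ _ => abs_nonneg _) hK0)
    exact Finset.sum_le_sum_of_subset_of_nonneg hsub fun _ _ _ => abs_nonneg _
  have h3 : ∑ b ∈ A ∪ N, expSum X c b ^ 2
      = ∑ b ∈ A, (expSum X c b ^ 2 + expSum X c (-b) ^ 2) := by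
    rw [Finset.sum_union hdisj, hN, Finset.sum_image (by simp), Finset.sum_add_distrib]
  rw [← h3]
  calc expSum X c 0 ^ 2 = |expSum X c 0| ^ 2 := (sq_abs _).symm
    _ ≤ (K * ∑ b ∈ A ∪ N, |expSum X c b|) ^ 2 := by gcongr
    _ = K ^ 2 * (∑ b ∈ A ∪ N, |expSum X c b|) ^ 2 := mul_pow _ _ _
    _ ≤ K ^ 2 * ((A ∪ N).card * ∑ b ∈ A ∪ N, |expSum X c b| ^ 2) := by
        gcongr
        exact sq_sum_le_card_mul_sum_sq
    _ = K ^ 2 * (A ∪ N).card * ∑ b ∈ A ∪ N, expSum X c b ^ 2 := by simp [mul_assoc]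
    _ ≤ (K ^ 2 * (A ∪ N).card + 1) * ∑ b ∈ A ∪ N, expSum X c b ^ 2 := by
        gcongr
        linarith

/-! ### The quadratic form of the matrix -/

theorem dotProduct_expSumSub_mulVec {k n : ℕ} (a : Fin k → ℝ) (ε : ℝ) (x c : Fin n → ℝ) :
    c ⬝ᵥ ((Matrix.of fun i j : Fin n => expSumSub a ε (x i + x j)).mulVec c)
      = ∑ m, ((∑ i, c i * Real.exp (x i * a m)) ^ 2 + (∑ i, c i * Real.exp (x i * -a m)) ^ 2)
        - ε * (∑ i, c i) ^ 2 := by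
  have h : ∀ s : ℝ, (∑ i, c i * Real.exp (x i * s)) ^ 2
      = ∑ i, ∑ j, c i * c j * Real.exp (s * (x i + x j)) := by
    intro s
    rw [sq, Finset.sum_mul_sum]
    refine Finset.sum_congr rfl fun i _ => Finset.sum_congr rfl fun j _ => ?_
    rw [show s * (x i + x j) = x i * s + x j * s by ring, Real.exp_add]
    ring
  have h' : (∑ i, c i) ^ 2 = ∑ i, ∑ j, c i * c j := by rw [sq, Finset.sum_mul_sum]
  simp only [h, h', ← Finset.sum_add_distrib]
  rw [Finset.sum_comm, Finset.mul_sum, ← Finset.sum_sub_distrib]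
  simp only [dotProduct, Matrix.mulVec, Matrix.of_apply, expSumSub]
  refine Finset.sum_congr rfl fun i _ => ?_
  rw [Finset.sum_comm, Finset.mul_sum, Finset.mul_sum, ← Finset.sum_sub_distrib]
  refine Finset.sum_congr rfl fun j _ => ?_
  simp only [← mul_add, ← Finset.mul_sum]
  ring

theorem expSumSub_isHermitian {k n : ℕ} (a : Fin k → ℝ) (ε : ℝ) (x : Fin n → ℝ) :
    (Matrix.of fun i j : Fin n => expSumSub a ε (x i + x j)).IsHermitian := by
  ext i j
  simp [add_comm]

theorem expSum_image_extend {n : ℕ} {x : Fin n → ℝ} (hx : Function.Injective x) (c : Fin n → ℝ)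
    (s : ℝ) : expSum (univ.image x) (Function.extend x c 0) s = ∑ i, c i * Real.exp (x i * s) := by
  rw [expSum, Finset.sum_image hx.injOn]
  simp [hx.extend_apply]

theorem exists_kPosDef_expSumSub {k : ℕ} (a : Fin k → ℝ) (ha : ∀ m, 0 < a m)
    (hinj : Function.Injective a) :
    ∃ ε₀ : ℝ, 0 < ε₀ ∧ ∀ ε : ℝ, 0 < ε → ε < ε₀ → KPosDef k (expSumSub a ε) := by
  set A : Finset ℝ := univ.image a with hA
  have hAcard : A.card = k := by simp [hA, card_image_of_injective _ hinj]
  obtain ⟨C, hC0, hC⟩ := exists_sq_expSum_zero_le A (by simpa [hA] using ha)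
  refine ⟨C⁻¹, inv_pos.2 hC0, fun ε hε hlt x hx => ?_⟩
  refine Matrix.PosDef.of_dotProduct_mulVec_pos (expSumSub_isHermitian a ε x) fun c hc => ?_
  rw [star_trivial, dotProduct_expSumSub_mulVec]
  set X : Finset ℝ := univ.image x with hX
  have hXcard : X.card = k := by simp [hX, card_image_of_injective _ hx]
  have hb := hC X (Function.extend x c 0) (hXcard.trans hAcard.symm)
  rw [hA, Finset.sum_image hinj.injOn] at hb
  simp only [hX, expSum_image_extend hx, mul_zero, Real.exp_zero, mul_one] at hb
  set Q := ∑ m, ((∑ i, c i * Real.exp (x i * a m)) ^ 2 + (∑ i, c i * Real.exp (x i * -a m)) ^ 2)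
    with hQ
  have hQpos : 0 < Q := by
    refine lt_of_le_of_ne (Finset.sum_nonneg fun _ _ => by positivity) fun h0 => hc ?_
    have hz := (Finset.sum_eq_zero_iff_of_nonneg (fun _ _ => by positivity)).1 h0.symm
    -- Q = 0 would give k zeros aₘ to a sum with k exponents xᵢ.
    have := coeff_eq_zero_of_card_le X (Function.extend x c 0) A (fun z hz' => by
      obtain ⟨m, -, rfl⟩ := mem_image.1 hz'
      rw [hX, expSum_image_extend hx]
      have := hz m (mem_univ _)
      exact pow_eq_zero_iff two_ne_zero |>.1
        ((add_eq_zero_iff_of_nonneg (sq_nonneg _) (sq_nonneg _)).1 this).1)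
      (by rw [hXcard, hAcard])
    funext i
    simpa [hx.extend_apply] using this (x i) (mem_image_of_mem _ (mem_univ i))
  have h1 : ε * C < 1 := by
    have := mul_lt_mul_of_pos_right hlt hC0
    rwa [inv_mul_cancel₀ hC0.ne'] at this
  nlinarith [mul_le_mul_of_nonneg_left hb hε.le]

-- At the points i + t, the coefficients of p = ∏ (X - exp aₘ) give F(s) = p(exp s) exp(ts). The
-- form therefore tends to -ε p(1)² < 0 as t → ∞.
open Polynomial in
theorem not_kPosSemidef_expSumSub {k : ℕ} (a : Fin k → ℝ) (ha : ∀ m, 0 < a m) {ε : ℝ}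
    (hε : 0 < ε) : ¬ KPosSemidef (k + 1) (expSumSub a ε) := by
  intro h
  set p : ℝ[X] := ∏ m, (X - C (Real.exp (a m))) with hp
  have hdeg : p.natDegree < k + 1 := by
    rw [hp, natDegree_finsetProd_X_sub_C_eq_card]
    simp
  have hroot : ∀ m, p.eval (Real.exp (a m)) = 0 := fun m => by
    rw [hp, eval_prod]
    exact Finset.prod_eq_zero (mem_univ m) (by simp)
  have hone : p.eval 1 ≠ 0 := by
    rw [hp, eval_prod, Finset.prod_ne_zero_iff]
    intro m _
    have := Real.one_lt_exp_iff.2 (ha m)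
    simp only [eval_sub, eval_X, eval_C]
    linarith
  have hval : ∀ t s : ℝ, ∑ i : Fin (k + 1), p.coeff i * Real.exp ((i + t) * s)
      = p.eval (Real.exp s) * Real.exp (t * s) := by
    intro t s
    rw [eval_eq_sum_range' hdeg, ← Fin.sum_univ_eq_sum_range, Finset.sum_mul]
    refine Finset.sum_congr rfl fun i _ => ?_
    rw [add_mul, Real.exp_add, ← Real.exp_nat_mul]
    ring
  have hnn : ∀ t : ℝ, 0 ≤ ∑ m, (p.eval (Real.exp (-a m)) * Real.exp (t * -a m)) ^ 2
      - ε * p.eval 1 ^ 2 := by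
    intro t
    have h1 := (h fun i => i + t).dotProduct_mulVec_nonneg fun i => p.coeff i
    rw [star_trivial, dotProduct_expSumSub_mulVec] at h1
    have h2 := hval t 0
    simp only [mul_zero, Real.exp_zero, mul_one] at h2
    simpa only [hval, hroot, h2, zero_mul, ne_eq, OfNat.ofNat_ne_zero, not_false_eq_true, zero_pow,
      zero_add] using h1
  have hlim : Filter.Tendsto (fun t : ℝ => ∑ m, (p.eval (Real.exp (-a m)) * Real.exp (t * -a m)) ^ 2
      - ε * p.eval 1 ^ 2) Filter.atTop
      (nhds (∑ m : Fin k, (p.eval (Real.exp (-a m)) * 0) ^ 2 - ε * p.eval 1 ^ 2)) := by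
    refine (tendsto_finsetSum _ fun m _ => ?_).sub_const _
    refine (Filter.Tendsto.const_mul _ ?_).pow 2
    exact Real.tendsto_exp_atBot.comp
      (Filter.tendsto_id.atTop_mul_const_of_neg (by simpa using ha m))
  have := ge_of_tendsto' hlim hnn
  simp only [mul_zero, ne_eq, OfNat.ofNat_ne_zero, not_false_eq_true, zero_pow,
    Finset.sum_const_zero, zero_sub] at this
  have : 0 < ε * p.eval 1 ^ 2 := by positivity
  linarith

end

theorem mainTheorem9 (k : ℕ) :
    (∃ f : ℝ → ℝ, KPosDef k f ∧ ¬ KPosSemidef (k + 1) f) ∧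
    ∀ a : Fin k → ℝ, (∀ m, 0 < a m) → StrictMono a →
      ∃ ε₀ : ℝ, 0 < ε₀ ∧ ∀ ε : ℝ, 0 < ε → ε < ε₀ →
        KPosDef k (expSumSub a ε) ∧ ¬ KPosSemidef (k + 1) (expSumSub a ε) := by
  have key : ∀ a : Fin k → ℝ, (∀ m, 0 < a m) → StrictMono a →
      ∃ ε₀ : ℝ, 0 < ε₀ ∧ ∀ ε : ℝ, 0 < ε → ε < ε₀ →
        KPosDef k (expSumSub a ε) ∧ ¬ KPosSemidef (k + 1) (expSumSub a ε) := by
    intro a ha hmono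
    obtain ⟨ε₀, h0, h⟩ := exists_kPosDef_expSumSub a ha hmono.injective
    exact ⟨ε₀, h0, fun ε h1 h2 => ⟨h ε h1 h2, not_kPosSemidef_expSumSub a ha h1⟩⟩
  refine ⟨?_, key⟩
  obtain ⟨ε₀, h0, h⟩ := key (fun m => (m : ℝ) + 1) (fun m => by positivity) fun i j hij => by
    simpa using hij
  exact ⟨_, h (ε₀ / 2) (by linarith) (by linarith)⟩
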